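/- Let $\mathbb R_+=(0,\infty)$ and write $p=\sigma+is$ with $\sigma,s\in\mathbb R$. For a complex-valued $f\in L^2(\mathbb R_+)$ let $$F(p)=\int_0^\infty e^{-pt}f(t)\,dt \qquad(\ast)$$ be its Laplace transform, where for $\sigma=0$ the integral $F(is)=\int_0^\infty e^{-ist}f(t)\,dt$ is understood as the Fourier transform in the sense of $L^2$ (of $f$ extended by zero). (1) Let $f\in L^2(\mathbb R_+)$ and let $F$ be given by $(\ast)$. Then the integral converges absolutely for $\sigma>0$, $F$ is analytic in the half-plane $\sigma>0$, $\lim_{\sigma\to0+}F(\sigma+is)=F(is)$ for almost every $s\in\mathbb R$, and $$\sup_{\sigma\ge 0}\int_{-\infty}^\infty|F(\sigma+is)|^2\,ds<\infty .$$ (2) Conversely, let $F$ be analytic in the half-plane $\sigma>0$ with $$\sup_{\sigma>0}\int_{-\infty}^\infty|F(\sigma+is)|^2\,ds<\infty .$$ Then there is $f\in L^2(\mathbb R_+)$ such that $F$ is given by $(\ast)$ for all $p$ with $\sigma>0$; moreover, for almost every $s\in\mathbb R$ the boundary value $F(is):=\lim_{\sigma\to0+}F(\sigma+is)$ exists and is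 given by $(\ast)$ with $\sigma=0$. (In particular this holds if the supremum over $\sigma\ge0$, including this boundary value, is finite.) -/

import Mathlib

open MeasureTheory Set Filter Topology FourierTransform
open scoped ENNReal

/-- The space `L²(ℝ₊)` of complex-valued functions, `ℝ₊ = (0, ∞)`. -/
abbrev L2HalfLine : Type := Lp ℂ 2 (volume.restrict (Ioi (0 : ℝ)))

/-- The extension of `f ∈ L²(ℝ₊)` by zero to an element of `L²(ℝ)`. -/
noncomputable def extendByZero (f : L2HalfLine) : Lp ℂ 2 (volume : Measure ℝ) :=
  MemLp.toLp ((Ioi (0 : ℝ)).indicator f)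
    ((memLp_indicator_iff_restrict measurableSet_Ioi).mpr (Lp.memLp f))

/-- The Laplace transform `F(p) = ∫₀^∞ e^{-pt} f(t) dt` of `f ∈ L²(ℝ₊)` on the closed half-plane
`Re p ≥ 0`. For `Re p > 0` the integral converges absolutely. On the line `p = is` the integral
`∫₀^∞ e^{-ist} f(t) dt` is the Fourier transform of `f` in the sense of `L²` (so it is determined
for almost every `s`); Mathlib normalises the Fourier transform with the kernel
`e^{-2πi t ξ}`, hence `ξ = s / (2π)`. Values at `Re p < 0` are not used. -/
noncomputable def laplaceTransform (f : L2HalfLine) (p : ℂ) : ℂ :=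
  if p.re = 0 then (𝓕 (extendByZero f) : Lp ℂ 2 (volume : Measure ℝ)) (p.im / (2 * Real.pi))
  else ∫ t in Ioi (0 : ℝ), Complex.exp (-p * (t : ℂ)) * f t

/-- The integral `∫_{-∞}^{∞} |F(σ + is)|² ds`, with values in `[0, ∞]`. -/
noncomputable def verticalL2 (F : ℂ → ℂ) (σ : ℝ) : ℝ≥0∞ :=
  ∫⁻ s : ℝ, ‖F ((σ : ℂ) + (s : ℂ) * Complex.I)‖ₑ ^ 2

/-! ### Square integrals -/

/-! This is the Paley–Wiener theorem, and it rests on Plancherel. On the line `Re p = σ > 0` the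
transform is, after `s = 2πξ`, the Fourier transform of the damped function `e^{-σt} f` extended by
zero. Damping does not increase the norm, so every vertical square integral is at most `2π ‖f‖²`.

Boundary values: Plancherel against `e^{-σ|t| + 2πixt}`, whose Fourier transform is a Poisson
kernel, writes `F(σ + 2πix)` as the Poisson integral at `x` of the `L²` transform of `f`
(`laplaceTransform_eq_integral_halfPlanePoisson`). The kernel is a positive mixture of indicators of
centred intervals, so the Poisson integrals converge at every Lebesgue point
(`ae_tendsto_integral_halfPlanePoisson`).

Converse: on each line, `F` is the Fourier transform of some `u_σ ∈ L²`. Paired with a test function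
`φ`, `e^{σt} u_σ` gives `(2π)⁻¹ ∫ Φ F ds` along that line, where `Φ(p) = ∫ e^{pt} φ(t) dt` is
entire. By Cauchy's theorem this does not depend on `σ` (`integral_vertical_eq`), so `u_σ = e^{-σt}
g` with a single `g`. The norms of `e^{-σt} g` are bounded uniformly in `σ`: letting `σ → ∞` forces
`g = 0` on `t < 0`, and letting `σ → 0` gives `g ∈ L²`. The boundary values of `F` then come from
the direct part. -/

theorem eLpNorm_two_sq_eq_lintegral {α : Type*} [MeasurableSpace α] (μ : Measure α) (g : α → ℂ) :
    eLpNorm g 2 μ ^ 2 = ∫⁻ x, ‖g x‖ₑ ^ 2 ∂μ := by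
  have := eLpNorm_nnreal_pow_eq_lintegral (μ := μ) (f := g) (p := 2) two_ne_zero
  simpa using this

theorem memLp_two_of_lintegral_lt_top {α : Type*} [MeasurableSpace α] {μ : Measure α} {g : α → ℂ}
    (hg : AEStronglyMeasurable g μ) (h : ∫⁻ x, ‖g x‖ₑ ^ 2 ∂μ < ∞) : MemLp g 2 μ := by
  refine ⟨hg, ?_⟩
  rw [← eLpNorm_two_sq_eq_lintegral] at h
  by_contra hc
  rw [not_lt, top_le_iff] at hc
  simp [hc] at h

theorem lintegral_sq_lt_top_of_memLp {α : Type*} [MeasurableSpace α] {μ : Measure α} {g : α → ℂ}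
    (hg : MemLp g 2 μ) : ∫⁻ x, ‖g x‖ₑ ^ 2 ∂μ < ∞ := by
  rw [← eLpNorm_two_sq_eq_lintegral]
  exact ENNReal.pow_lt_top hg.2

theorem lintegral_comp_mul_pos {a : ℝ} (ha : 0 < a) (φ : ℝ → ℝ≥0∞) :
    ENNReal.ofReal a * ∫⁻ x, φ (a * x) = ∫⁻ x, φ x := by
  let e : ℝ ≃ᵐ ℝ := MeasurableEquiv.mulLeft₀ a ha.ne'
  have h := Real.map_volume_mul_left ha.ne'
  have h3 : ∫⁻ x, φ x ∂(Measure.map e volume) = ∫⁻ x, φ (e x) := lintegral_map_equiv φ e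
  have h4 : Measure.map e volume = ENNReal.ofReal |a⁻¹| • (volume : Measure ℝ) := h
  rw [h4, lintegral_smul_measure] at h3
  change _ = ∫⁻ x, φ (a * x) at h3
  rw [← h3, smul_eq_mul, ← mul_assoc, ← ENNReal.ofReal_mul ha.le, abs_of_pos (by positivity),
    mul_inv_cancel₀ ha.ne', ENNReal.ofReal_one, one_mul]

theorem lintegral_comp_div_two_pi (φ : ℝ → ℝ≥0∞) :
    ∫⁻ s, φ (s / (2 * Real.pi)) = ENNReal.ofReal (2 * Real.pi) * ∫⁻ ξ, φ ξ := by
  have h2 : (2 * Real.pi) ≠ 0 := by positivity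
  rw [← lintegral_comp_mul_pos (a := 2 * Real.pi) (by positivity)]
  simp only [mul_div_cancel_left₀ _ h2]

theorem quasiMeasurePreserving_div_two_pi :
    Measure.QuasiMeasurePreserving (fun s : ℝ => s / (2 * Real.pi)) volume volume := by
  have h2 : (2 * Real.pi) ≠ 0 := by positivity
  refine ⟨by fun_prop, ?_⟩
  have h := Real.map_volume_mul_right (inv_ne_zero h2)
  simp only [div_eq_mul_inv]
  rw [h]
  exact Measure.smul_absolutelyContinuous

/-! ### The `L²` Fourier transform of integrable functions -/

/-- Both sides have the same integrals against test functions: on the left through the Fourier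
transform of tempered distributions, on the right through Fubini. Locally integrable functions are
determined a.e. by such integrals. -/
theorem fourier_toLp_two_ae_eq {g : ℝ → ℂ} (h1 : Integrable g) (h2 : MemLp g 2) :
    (𝓕 (h2.toLp g) : Lp ℂ 2 (volume : Measure ℝ)) =ᵐ[volume] 𝓕 g := by
  have hcont : Continuous (𝓕 g) :=
    VectorFourier.fourierIntegral_continuous Real.continuous_fourierChar
      (innerSL ℝ).continuous₂ h1
  refine ae_eq_of_integral_contDiff_smul_eq ((Lp.memLp _).locallyIntegrable (by norm_num))
    hcont.locallyIntegrable fun φ hφ hφc => ?_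
  have hg₁ : HasCompactSupport (Complex.ofRealCLM ∘ φ) := hφc.comp_left rfl
  have hg₂ : ContDiff ℝ (⊤ : ℕ∞) (Complex.ofRealCLM ∘ φ) := by fun_prop
  set Φ := hg₁.toSchwartzMap hg₂ with hΦ
  have hΦa : ∀ x, Φ x = (φ x : ℂ) := fun x => rfl
  have e1 := congrArg (fun T => T Φ) (Lp.fourier_toTemperedDistribution_eq (h2.toLp g))
  simp only [TemperedDistribution.fourier_apply, Lp.toTemperedDistribution_apply, hΦa] at e1
  have e2 : ∫ x, (𝓕 Φ) x • (h2.toLp g) x = ∫ x, (𝓕 Φ) x • g x := by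
    refine integral_congr_ae ?_
    filter_upwards [h2.coeFn_toLp] with x hx
    rw [hx]
  have e3 : ∫ x, (𝓕 Φ) x • g x = ∫ x, Φ x • 𝓕 g x := by
    have := VectorFourier.integral_fourierIntegral_smul_eq_flip (L := innerₗ ℝ) (μ := volume)
      (ν := volume) Real.continuous_fourierChar continuous_inner Φ.integrable h1
    rw [flip_innerₗ] at this
    exact this
  simp only [← Complex.coe_smul]
  rw [← e1, e2, e3]
  simp [hΦa]

/-! ### Exponential integrals -/

/-- Differentiation under the integral. Of the margin `2ε`, one `ε` pays for moving `q` in the ball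
and one for the factor `t` of the derivative, since `1 + ε|t| ≤ e^{ε|t|}`. The two exponentials
dominate for `t ≥ 0` and `t ≤ 0` respectively. -/
theorem differentiableAt_integral_exp_mul {w : ℝ → ℂ} (hw : AEStronglyMeasurable w) {p : ℂ} {ε : ℝ}
    (hε : 0 < ε)
    (h1 : Integrable (fun t : ℝ => Real.exp ((p.re + 2 * ε) * t) * ‖w t‖))
    (h2 : Integrable (fun t : ℝ => Real.exp ((p.re - 2 * ε) * t) * ‖w t‖)) :
    DifferentiableAt ℂ (fun q : ℂ => ∫ t : ℝ, Complex.exp (q * t) * w t) p := by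
  have hexp : ∀ (q : ℂ), |q.re - p.re| ≤ ε → ∀ t : ℝ, (1 + |t| * ε) * ‖Complex.exp (q * t)‖ ≤
      Real.exp ((p.re + 2 * ε) * t) + Real.exp ((p.re - 2 * ε) * t) := by
    intro q hq t
    have hre : ‖Complex.exp (q * t)‖ = Real.exp (q.re * t) := by
      rw [Complex.norm_exp]; simp
    rw [hre]
    have ha : 1 + |t| * ε ≤ Real.exp (|t| * ε) := by
      rw [add_comm]; exact Real.add_one_le_exp _
    have hq' := abs_le.mp hq
    calc (1 + |t| * ε) * Real.exp (q.re * t)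
        ≤ Real.exp (|t| * ε) * Real.exp (q.re * t) := by gcongr
      _ = Real.exp (|t| * ε + q.re * t) := by rw [Real.exp_add]
      _ ≤ _ := by
        rcases le_total 0 t with ht | ht
        · rw [abs_of_nonneg ht]
          refine le_add_of_le_of_nonneg (Real.exp_le_exp.mpr ?_) (Real.exp_pos _).le
          nlinarith
        · rw [abs_of_nonpos ht]
          refine le_add_of_nonneg_of_le (Real.exp_pos _).le (Real.exp_le_exp.mpr ?_)
          nlinarith
  have hnn : ∀ t : ℝ, 0 ≤ |t| * ε := fun t => by positivity
  have hexpm : ∀ q : ℂ, AEStronglyMeasurable (fun t : ℝ => Complex.exp (q * t) * w t) := fun q =>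
    (Continuous.aestronglyMeasurable (by fun_prop)).mul hw
  have hint := h1.add h2
  refine (hasDerivAt_integral_of_dominated_loc_of_deriv_le (𝕜 := ℂ) (μ := volume)
    (F := fun (q : ℂ) (t : ℝ) => Complex.exp (q * t) * w t)
    (F' := fun (q : ℂ) (t : ℝ) => (t : ℂ) * (Complex.exp (q * t) * w t))
    (bound := fun t : ℝ => ε⁻¹ * (Real.exp ((p.re + 2 * ε) * t) * ‖w t‖ +
      Real.exp ((p.re - 2 * ε) * t) * ‖w t‖))
    (Metric.ball_mem_nhds p hε) (.of_forall hexpm) ?_ ?_ ?_ ?_ ?_).2.differentiableAt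
  · refine hint.mono' (hexpm p) (.of_forall fun t => ?_)
    have := hexp p (by simpa using hε.le) t
    rw [norm_mul]
    calc _ ≤ ((1 + |t| * ε) * ‖Complex.exp (p * t)‖) * ‖w t‖ := by
          gcongr
          nlinarith [norm_nonneg (Complex.exp (p * t)), hnn t]
      _ ≤ _ := by
          simp only [Pi.add_apply]
          rw [← add_mul]
          gcongr
  · exact (Continuous.aestronglyMeasurable (by fun_prop)).mul (hexpm p)
  · refine .of_forall fun t q hq => ?_
    have hq' : |q.re - p.re| ≤ ε := by
      rw [Metric.mem_ball, Complex.dist_eq] at hq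
      exact (Complex.abs_re_le_norm (q - p)).trans hq.le
    have := hexp q hq' t
    rw [norm_mul, norm_mul, Complex.norm_real, Real.norm_eq_abs, ← add_mul, ← mul_assoc,
      ← mul_assoc]
    refine mul_le_mul_of_nonneg_right ?_ (norm_nonneg _)
    rw [le_inv_mul_iff₀ hε]
    nlinarith [norm_nonneg (Complex.exp (q * t)), hnn t]
  · exact hint.const_mul _
  · refine .of_forall fun t q _ => ?_
    have h := (((hasDerivAt_id q).mul_const (t : ℂ)).cexp).mul_const (w t)
    refine h.congr_deriv ?_
    simp only [id]; ring

/-! ### The two-sided exponential -/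

theorem integrableOn_Iic_exp_mul_abs {σ : ℝ} (hσ : 0 < σ) (x : ℝ) :
    IntegrableOn (fun t : ℝ => Complex.exp (-σ * |t| + x * t * Complex.I)) (Iic 0) := by
  refine (integrableOn_exp_mul_complex_Iic (a := σ + x * Complex.I) (by simpa using hσ) 0).congr_fun
    (fun t ht => ?_) measurableSet_Iic
  simp only
  rw [abs_of_nonpos ht]
  push_cast; ring_nf

theorem integrableOn_Ioi_exp_mul_abs {σ : ℝ} (hσ : 0 < σ) (x : ℝ) :
    IntegrableOn (fun t : ℝ => Complex.exp (-σ * |t| + x * t * Complex.I)) (Ioi 0) := by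
  refine (integrableOn_exp_mul_complex_Ioi (a := -σ + x * Complex.I) (by simpa using hσ) 0).congr_fun
    (fun t ht => ?_) measurableSet_Ioi
  simp only
  rw [abs_of_pos ht]
  congr 1; ring

theorem integrable_exp_mul_abs_complex {σ : ℝ} (hσ : 0 < σ) (x : ℝ) :
    Integrable (fun t : ℝ => Complex.exp (-σ * |t| + x * t * Complex.I)) := by
  rw [← integrableOn_univ, ← Iic_union_Ioi (a := (0 : ℝ))]
  exact (integrableOn_Iic_exp_mul_abs hσ x).union (integrableOn_Ioi_exp_mul_abs hσ x)

theorem integral_exp_mul_abs_complex {σ : ℝ} (hσ : 0 < σ) (x : ℝ) :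
    ∫ t : ℝ, Complex.exp (-σ * |t| + x * t * Complex.I) = ((2 * σ / (σ ^ 2 + x ^ 2) : ℝ) : ℂ) := by
  rw [← intervalIntegral.integral_Iic_add_Ioi (integrableOn_Iic_exp_mul_abs hσ x)
    (integrableOn_Ioi_exp_mul_abs hσ x)]
  have e1 : ∫ t in Iic (0 : ℝ), Complex.exp (-σ * |t| + x * t * Complex.I) =
      1 / (σ + x * Complex.I) := by
    rw [setIntegral_congr_fun (g := fun t : ℝ => Complex.exp ((σ + x * Complex.I) * t))
      measurableSet_Iic, integral_exp_mul_complex_Iic (by simpa using hσ)]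
    · simp
    · intro t ht
      simp only
      rw [abs_of_nonpos ht]
      congr 1; push_cast; ring
  have e2 : ∫ t in Ioi (0 : ℝ), Complex.exp (-σ * |t| + x * t * Complex.I) =
      -1 / (-σ + x * Complex.I) := by
    rw [setIntegral_congr_fun (g := fun t : ℝ => Complex.exp ((-σ + x * Complex.I) * t))
      measurableSet_Ioi, integral_exp_mul_complex_Ioi (by simpa using hσ)]
    · simp
    · intro t ht
      simp only
      rw [abs_of_pos ht]
      congr 1; ring
  have h1 : (σ + x * Complex.I : ℂ) ≠ 0 := fun h => hσ.ne' (by simpa using congrArg Complex.re h)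
  have h2 : (-σ + x * Complex.I : ℂ) ≠ 0 := fun h => hσ.ne' (by simpa using congrArg Complex.re h)
  have h3 : (σ ^ 2 + x ^ 2 : ℂ) ≠ 0 := by
    have : (σ ^ 2 + x ^ 2 : ℝ) ≠ 0 := by positivity
    exact_mod_cast this
  rw [e1, e2]
  push_cast
  rw [div_add_div _ _ h1 h2, div_eq_div_iff (mul_ne_zero h1 h2) h3]
  linear_combination (-2 * σ * x ^ 2 : ℂ) * Complex.I_sq

/-! ### The Laplace transform of an `L²` function -/

theorem memLp_indicator_L2HalfLine (f : L2HalfLine) : MemLp ((Ioi (0 : ℝ)).indicator f) 2 :=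
  (memLp_indicator_iff_restrict measurableSet_Ioi).mpr (Lp.memLp f)

theorem memLp_two_exp_neg_mul_abs {σ : ℝ} (hσ : 0 < σ) :
    MemLp (fun t : ℝ => (Real.exp (-σ * |t|) : ℂ)) 2 := by
  have hm : AEStronglyMeasurable (fun t : ℝ => (Real.exp (-σ * |t|) : ℂ)) :=
    Continuous.aestronglyMeasurable (by fun_prop)
  rw [memLp_two_iff_integrable_sq_norm hm]
  have : Integrable fun t : ℝ => Real.exp (-(2 * σ) * |t|) := by
    refine (integrable_exp_mul_abs_complex (σ := 2 * σ) (by positivity) 0).norm.congr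
      (.of_forall fun t => ?_)
    simp only [Complex.norm_exp]
    simp
  refine this.congr (.of_forall fun t => ?_)
  simp only
  rw [Complex.norm_real, Real.norm_of_nonneg (Real.exp_pos _).le, ← Real.exp_nat_mul]
  congr 1
  push_cast; ring

/-- The damped extension by zero `1_{t > 0} e^{-σt} f(t)`. -/
noncomputable def dampedExtension (f : L2HalfLine) (σ t : ℝ) : ℂ :=
  (Real.exp (-σ * |t|) : ℂ) * (Ioi (0 : ℝ)).indicator f t

theorem integrable_dampedExtension (f : L2HalfLine) {σ : ℝ} (hσ : 0 < σ) :
    Integrable (dampedExtension f σ) :=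
  (memLp_two_exp_neg_mul_abs hσ).integrable_mul (memLp_indicator_L2HalfLine f)

theorem norm_dampedExtension_le (f : L2HalfLine) {σ : ℝ} (hσ : 0 ≤ σ) (t : ℝ) :
    ‖dampedExtension f σ t‖ ≤ ‖(Ioi (0 : ℝ)).indicator f t‖ := by
  rw [dampedExtension, norm_mul, Complex.norm_real, Real.norm_of_nonneg (Real.exp_pos _).le]
  refine mul_le_of_le_one_left (norm_nonneg _) (Real.exp_le_one_iff.mpr ?_)
  nlinarith [abs_nonneg t]

theorem memLp_dampedExtension (f : L2HalfLine) {σ : ℝ} (hσ : 0 ≤ σ) :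
    MemLp (dampedExtension f σ) 2 :=
  (memLp_indicator_L2HalfLine f).mono
    ((Continuous.aestronglyMeasurable (by fun_prop)).mul (memLp_indicator_L2HalfLine f).1)
    (.of_forall (norm_dampedExtension_le f hσ))

theorem exp_mul_eq_dampedExtension (f : L2HalfLine) (σ ξ t : ℝ) :
    (Ioi (0 : ℝ)).indicator
      (fun t : ℝ => Complex.exp (-((σ : ℂ) + ((2 * Real.pi * ξ : ℝ) : ℂ) * Complex.I) * t) * f t) t =
    Real.fourierChar (-(t * ξ)) • dampedExtension f σ t := by
  by_cases ht : t ∈ Ioi (0 : ℝ)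
  · rw [dampedExtension, indicator_of_mem ht, indicator_of_mem ht, abs_of_pos ht, Circle.smul_def,
      Real.fourierChar_apply, smul_eq_mul, ← mul_assoc, Complex.ofReal_exp, ← Complex.exp_add]
    congr 2
    push_cast; ring
  · simp [dampedExtension, indicator_of_notMem ht]

theorem integrableOn_exp_mul (f : L2HalfLine) {p : ℂ} (hp : 0 < p.re) :
    IntegrableOn (fun t : ℝ => Complex.exp (-p * (t : ℂ)) * f t) (Ioi 0) := by
  rw [← integrable_indicator_iff measurableSet_Ioi]
  have h2 : (2 * Real.pi) ≠ 0 := by positivity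
  have h := (Real.fourierIntegral_convergent_iff (p.im / (2 * Real.pi))).mpr
    (integrable_dampedExtension f hp)
  refine h.congr (.of_forall fun t => ?_)
  have := exp_mul_eq_dampedExtension f p.re (p.im / (2 * Real.pi)) t
  rw [mul_div_cancel₀ _ h2, Complex.re_add_im] at this
  simp only [this]
  simp [mul_comm]

theorem fourier_dampedExtension (f : L2HalfLine) {σ : ℝ} (hσ : σ ≠ 0) (ξ : ℝ) :
    𝓕 (dampedExtension f σ) ξ =
      laplaceTransform f ((σ : ℂ) + ((2 * Real.pi * ξ : ℝ) : ℂ) * Complex.I) := by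
  rw [laplaceTransform, if_neg (by simpa using hσ), ← integral_indicator measurableSet_Ioi,
    Real.fourier_real_eq]
  exact integral_congr_ae (.of_forall fun t => (exp_mul_eq_dampedExtension f σ ξ t).symm)

theorem analyticOnNhd_laplaceTransform (f : L2HalfLine) :
    AnalyticOnNhd ℂ (laplaceTransform f) {p : ℂ | 0 < p.re} := by
  have hopen : IsOpen {p : ℂ | 0 < p.re} := isOpen_lt continuous_const Complex.continuous_re
  refine DifferentiableOn.analyticOnNhd (fun p hp => DifferentiableAt.differentiableWithinAt ?_)
    hopen
  have hp : 0 < p.re := hp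
  set w : ℝ → ℂ := (Ioi (0 : ℝ)).indicator f with hw
  have hd : ∀ σ : ℝ, 0 < σ → Integrable (fun t : ℝ => Real.exp (-σ * t) * ‖w t‖) := by
    intro σ hσ
    refine (integrable_dampedExtension f hσ).norm.congr (.of_forall fun t => ?_)
    by_cases ht : t ∈ Ioi (0 : ℝ)
    · simp only [dampedExtension]
      rw [norm_mul, Complex.norm_real, Real.norm_of_nonneg (Real.exp_pos _).le, abs_of_pos ht]
    · simp [dampedExtension, hw, indicator_of_notMem ht]
  have h := differentiableAt_integral_exp_mul (w := w) (memLp_indicator_L2HalfLine f).1 (p := -p)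
    (ε := p.re / 4) (by positivity)
    ((hd (p.re / 2) (by positivity)).congr (.of_forall fun t => by
      simp only [Complex.neg_re]; congr 2; ring))
    ((hd (p.re * (3 / 2)) (by positivity)).congr (.of_forall fun t => by
      simp only [Complex.neg_re]; congr 2; ring))
  have h' := h.comp p differentiable_neg.differentiableAt
  refine h'.congr_of_eventuallyEq ?_
  filter_upwards [hopen.mem_nhds hp] with q hq
  rw [laplaceTransform, if_neg (ne_of_gt hq), ← integral_indicator measurableSet_Ioi]
  refine integral_congr_ae (.of_forall fun t => ?_)
  simp only [hw]
  rw [indicator_mul_right _ (fun t : ℝ => Complex.exp (-q * t))]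

/-- The substitution `s = 2πξ`. Equality is only asked a.e. because `G` is often a representative of
an `L²` class. -/
theorem verticalL2_eq_of_ae_eq {F : ℂ → ℂ} {σ : ℝ} {G : ℝ → ℂ}
    (h : ∀ᵐ ξ : ℝ, F ((σ : ℂ) + ((2 * Real.pi * ξ : ℝ) : ℂ) * Complex.I) = G ξ) :
    verticalL2 F σ = ENNReal.ofReal (2 * Real.pi) * ∫⁻ ξ, ‖G ξ‖ₑ ^ 2 := by
  have h2 : (2 * Real.pi) ≠ 0 := by positivity
  rw [verticalL2, ← lintegral_comp_div_two_pi]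
  refine lintegral_congr_ae ?_
  filter_upwards [quasiMeasurePreserving_div_two_pi.ae h] with s hs
  rw [← hs, mul_div_cancel₀ _ h2]

theorem lintegral_fourier_toLp {g : ℝ → ℂ} (hg : MemLp g 2) :
    ∫⁻ ξ, ‖(𝓕 (hg.toLp g) : Lp ℂ 2 (volume : Measure ℝ)) ξ‖ₑ ^ 2 = ∫⁻ t, ‖g t‖ₑ ^ 2 := by
  have := Lp.norm_fourier_eq (hg.toLp g)
  rw [← eLpNorm_two_sq_eq_lintegral, ← eLpNorm_two_sq_eq_lintegral,
    ← eLpNorm_congr_ae hg.coeFn_toLp]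
  rw [Lp.norm_def, Lp.norm_def, ENNReal.toReal_eq_toReal_iff' (Lp.memLp _).2.ne
    (Lp.memLp _).2.ne] at this
  rw [this]

theorem verticalL2_laplaceTransform_le (f : L2HalfLine) {σ : ℝ} (hσ : 0 ≤ σ) :
    verticalL2 (laplaceTransform f) σ ≤
      ENNReal.ofReal (2 * Real.pi) * ∫⁻ t, ‖(Ioi (0 : ℝ)).indicator f t‖ₑ ^ 2 := by
  have h2 : (2 * Real.pi) ≠ 0 := by positivity
  rcases hσ.eq_or_lt with rfl | hσ'
  · rw [verticalL2_eq_of_ae_eq (G := (𝓕 (extendByZero f) : Lp ℂ 2 (volume : Measure ℝ))),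
      extendByZero, lintegral_fourier_toLp]
    refine .of_forall fun ξ => ?_
    rw [laplaceTransform, if_pos (by simp)]
    congr 1
    simp [mul_div_cancel_left₀ _ h2]
  · have hm := memLp_dampedExtension f hσ
    rw [verticalL2_eq_of_ae_eq (G := (𝓕 (hm.toLp _) : Lp ℂ 2 (volume : Measure ℝ))),
      lintegral_fourier_toLp]
    · gcongr with t
      exact enorm_le_iff_norm_le.mpr (norm_dampedExtension_le f hσ t)
    · filter_upwards [fourier_toLp_two_ae_eq (integrable_dampedExtension f hσ') hm] with ξ hξ
      rw [hξ, fourier_dampedExtension f hσ'.ne']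

/-! ### The Poisson kernel of the half-plane -/

/-- The Poisson kernel of the right half-plane, in the frequency variable `ξ = s / 2π`. -/
noncomputable def halfPlanePoisson (σ v : ℝ) : ℝ := 2 * σ / (σ ^ 2 + (2 * Real.pi * v) ^ 2)

/-- Minus the derivative of `halfPlanePoisson σ`. -/
noncomputable def halfPlanePoissonSlope (σ r : ℝ) : ℝ :=
  16 * Real.pi ^ 2 * σ * r / (σ ^ 2 + (2 * Real.pi * r) ^ 2) ^ 2

theorem halfPlanePoisson_nonneg {σ : ℝ} (hσ : 0 < σ) (v : ℝ) : 0 ≤ halfPlanePoisson σ v := by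
  unfold halfPlanePoisson; positivity

theorem continuous_halfPlanePoisson {σ : ℝ} (hσ : 0 < σ) : Continuous (halfPlanePoisson σ) := by
  unfold halfPlanePoisson
  exact continuous_const.div (by fun_prop) fun v => by positivity

theorem continuous_halfPlanePoissonSlope {σ : ℝ} (hσ : 0 < σ) :
    Continuous (halfPlanePoissonSlope σ) := by
  unfold halfPlanePoissonSlope
  exact Continuous.div (by fun_prop) (by fun_prop) fun v => by positivity

theorem halfPlanePoisson_eq {σ : ℝ} (hσ : 0 < σ) (v : ℝ) :
    halfPlanePoisson σ v = 2 / σ * (1 + (2 * Real.pi / σ * v) ^ 2)⁻¹ := by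
  unfold halfPlanePoisson
  field_simp

theorem integrable_halfPlanePoisson {σ : ℝ} (hσ : 0 < σ) : Integrable (halfPlanePoisson σ) := by
  have h : (2 * Real.pi / σ) ≠ 0 := by positivity
  exact ((integrable_inv_one_add_sq.comp_mul_left' h).const_mul (2 / σ)).congr
    (.of_forall fun v => (halfPlanePoisson_eq hσ v).symm)

theorem integral_halfPlanePoisson {σ : ℝ} (hσ : 0 < σ) : ∫ v, halfPlanePoisson σ v = 1 := by
  simp only [halfPlanePoisson_eq hσ]
  rw [integral_const_mul, Measure.integral_comp_mul_left (fun y : ℝ => (1 + y ^ 2)⁻¹),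
    integral_univ_inv_one_add_sq, abs_of_pos (by positivity), smul_eq_mul]
  field_simp

theorem halfPlanePoisson_le {σ : ℝ} (hσ : 0 < σ) (v : ℝ) : halfPlanePoisson σ v ≤ 2 / σ := by
  rw [halfPlanePoisson_eq hσ]
  exact mul_le_of_le_one_right (by positivity)
    (inv_le_one_of_one_le₀ (by nlinarith [sq_nonneg (2 * Real.pi / σ * v)]))

theorem memLp_two_halfPlanePoisson {σ : ℝ} (hσ : 0 < σ) :
    MemLp (fun v => (halfPlanePoisson σ v : ℂ)) 2 := by
  have hm : AEStronglyMeasurable (fun v => (halfPlanePoisson σ v : ℂ)) :=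
    (Complex.continuous_ofReal.comp (continuous_halfPlanePoisson hσ)).aestronglyMeasurable
  rw [memLp_two_iff_integrable_sq_norm hm]
  refine ((integrable_halfPlanePoisson hσ).const_mul (2 / σ)).mono' (hm.norm.pow 2)
    (.of_forall fun v => ?_)
  have h0 := halfPlanePoisson_nonneg hσ v
  rw [Real.norm_of_nonneg (by positivity), Complex.norm_real, Real.norm_of_nonneg h0, sq]
  exact mul_le_mul_of_nonneg_right (halfPlanePoisson_le hσ v) h0

theorem hasDerivAt_neg_halfPlanePoisson {σ : ℝ} (hσ : 0 < σ) (r : ℝ) :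
    HasDerivAt (fun r => -halfPlanePoisson σ r) (halfPlanePoissonSlope σ r) r := by
  have h1 : HasDerivAt (fun r : ℝ => σ ^ 2 + (2 * Real.pi * r) ^ 2)
      (2 * (2 * Real.pi * r) * (2 * Real.pi)) r := by
    have := (((hasDerivAt_id r).const_mul (2 * Real.pi)).pow 2).const_add (σ ^ 2)
    refine this.congr_deriv ?_
    simp
  have h0 : σ ^ 2 + (2 * Real.pi * r) ^ 2 ≠ 0 := by positivity
  refine (((hasDerivAt_const r (2 * σ)).div h1 h0).neg).congr_deriv ?_
  unfold halfPlanePoissonSlope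
  rw [← neg_div]
  congr 1
  ring

theorem tendsto_halfPlanePoisson_atTop (σ : ℝ) :
    Tendsto (halfPlanePoisson σ) atTop (𝓝 0) := by
  refine Tendsto.div_atTop tendsto_const_nhds (tendsto_atTop_add_const_left _ _ ?_)
  exact (tendsto_pow_atTop two_ne_zero).comp (tendsto_id.const_mul_atTop (by positivity))

theorem halfPlanePoissonSlope_nonneg {σ r : ℝ} (hσ : 0 < σ) (hr : 0 ≤ r) :
    0 ≤ halfPlanePoissonSlope σ r := by
  unfold halfPlanePoissonSlope; positivity

theorem halfPlanePoissonSlope_nonpos {σ r : ℝ} (hσ : 0 < σ) (hr : r ≤ 0) :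
    halfPlanePoissonSlope σ r ≤ 0 := by
  unfold halfPlanePoissonSlope
  refine div_nonpos_of_nonpos_of_nonneg ?_ (by positivity)
  exact mul_nonpos_of_nonneg_of_nonpos (by positivity) hr

/-- Layer-cake form: the kernel is even and decreases to zero in `|v|`, so it is a superposition of
indicators of the intervals `(-r, r)`, weighted by minus its derivative. -/
theorem ofReal_halfPlanePoisson_eq_lintegral {σ : ℝ} (hσ : 0 < σ) (v : ℝ) :
    ENNReal.ofReal (halfPlanePoisson σ v) =
      ∫⁻ r in Ioi |v|, ENNReal.ofReal (halfPlanePoissonSlope σ r) := by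
  have hnn : ∀ r ∈ Ioi |v|, 0 ≤ halfPlanePoissonSlope σ r := fun r hr =>
    halfPlanePoissonSlope_nonneg hσ ((abs_nonneg v).trans hr.le)
  have hlim : Tendsto (fun r => -halfPlanePoisson σ r) atTop (𝓝 0) := by
    simpa using (tendsto_halfPlanePoisson_atTop σ).neg
  have hi := integrableOn_Ioi_deriv_of_nonneg'
    (fun r _ => hasDerivAt_neg_halfPlanePoisson hσ r) hnn hlim
  rw [← ofReal_integral_eq_lintegral_ofReal hi (ae_restrict_of_forall_mem measurableSet_Ioi hnn),
    integral_Ioi_of_hasDerivAt_of_nonneg' (fun r _ => hasDerivAt_neg_halfPlanePoisson hσ r)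
      hnn hlim]
  simp [halfPlanePoisson, mul_pow]

/-- Tonelli on the region `|v| < r`. Values `r ≤ 0` contribute nothing, as the interval is then
empty. -/
theorem lintegral_halfPlanePoisson_mul {σ : ℝ} (hσ : 0 < σ) {h : ℝ → ℝ≥0∞} (hh : Measurable h) :
    ∫⁻ v, ENNReal.ofReal (halfPlanePoisson σ v) * h v =
      ∫⁻ r, ENNReal.ofReal (halfPlanePoissonSlope σ r) * ∫⁻ v in Ioo (-r) r, h v := by
  have hset : MeasurableSet {z : ℝ × ℝ | |z.1| < z.2} :=
    measurableSet_lt (by fun_prop) measurable_snd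
  have hQ : Measurable fun r => ENNReal.ofReal (halfPlanePoissonSlope σ r) :=
    (continuous_halfPlanePoissonSlope hσ).measurable.ennreal_ofReal
  calc ∫⁻ v, ENNReal.ofReal (halfPlanePoisson σ v) * h v
      = ∫⁻ v, ∫⁻ r, {z : ℝ × ℝ | |z.1| < z.2}.indicator
          (fun z => ENNReal.ofReal (halfPlanePoissonSlope σ z.2) * h z.1) (v, r) := by
        refine lintegral_congr fun v => ?_
        rw [ofReal_halfPlanePoisson_eq_lintegral hσ, ← lintegral_mul_const _ hQ,
          ← lintegral_indicator measurableSet_Ioi]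
        rfl
    _ = ∫⁻ r, ∫⁻ v, {z : ℝ × ℝ | |z.1| < z.2}.indicator
          (fun z => ENNReal.ofReal (halfPlanePoissonSlope σ z.2) * h z.1) (v, r) := by
        refine lintegral_lintegral_swap (Measurable.aemeasurable ?_)
        exact Measurable.indicator ((hQ.comp measurable_snd).mul (hh.comp measurable_fst)) hset
    _ = _ := by
        refine lintegral_congr fun r => ?_
        rw [← lintegral_const_mul _ hh, ← lintegral_indicator measurableSet_Ioo]
        refine lintegral_congr fun v => ?_
        simp only [indicator, mem_ofPred_eq, mem_Ioo, abs_lt]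

/-- Setting `r = σρ` makes the weight independent of `σ`, as dominated convergence for `σ → 0`
requires. -/
theorem lintegral_halfPlanePoisson_mul_scaled {σ : ℝ} (hσ : 0 < σ) {h : ℝ → ℝ≥0∞}
    (hh : Measurable h) :
    ∫⁻ v, ENNReal.ofReal (halfPlanePoisson σ v) * h v =
      ∫⁻ ρ, ENNReal.ofReal (halfPlanePoissonSlope 1 ρ) *
        ((∫⁻ v in Ioo (-(σ * ρ)) (σ * ρ), h v) / ENNReal.ofReal σ) := by
  rw [lintegral_halfPlanePoisson_mul hσ hh, ← lintegral_comp_mul_pos hσ,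
    ← lintegral_const_mul' _ _ ENNReal.ofReal_ne_top]
  refine lintegral_congr fun ρ => ?_
  have e : halfPlanePoissonSlope σ (σ * ρ) = halfPlanePoissonSlope 1 ρ * σ⁻¹ * σ⁻¹ := by
    unfold halfPlanePoissonSlope
    field_simp
  rw [e, ENNReal.ofReal_mul' (by positivity), ENNReal.ofReal_mul' (by positivity),
    ENNReal.ofReal_inv_of_pos hσ, div_eq_mul_inv]
  have hc : ENNReal.ofReal σ * (ENNReal.ofReal σ)⁻¹ = 1 :=
    ENNReal.mul_inv_cancel (by simpa using hσ) ENNReal.ofReal_ne_top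
  calc _ = (ENNReal.ofReal σ * (ENNReal.ofReal σ)⁻¹) * (ENNReal.ofReal (halfPlanePoissonSlope 1 ρ) *
        ((∫⁻ v in Ioo (-(σ * ρ)) (σ * ρ), h v) * (ENNReal.ofReal σ)⁻¹)) := by ring
    _ = _ := by rw [hc, one_mul]

theorem integrable_halfPlanePoissonSlope_mul_id :
    Integrable fun ρ => halfPlanePoissonSlope 1 ρ * ρ := by
  refine (integrable_inv_one_add_sq.const_mul 4).mono'
    ((continuous_halfPlanePoissonSlope one_pos).mul continuous_id).aestronglyMeasurable
    (.of_forall fun ρ => ?_)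
  have e : halfPlanePoissonSlope 1 ρ * ρ =
      4 * ((2 * Real.pi * ρ) ^ 2 / (1 + (2 * Real.pi * ρ) ^ 2)) *
        (1 + (2 * Real.pi * ρ) ^ 2)⁻¹ := by
    unfold halfPlanePoissonSlope
    rw [one_pow]
    field_simp
    ring
  have h1 : (2 * Real.pi * ρ) ^ 2 / (1 + (2 * Real.pi * ρ) ^ 2) ≤ 1 := by
    rw [div_le_one (by positivity)]; linarith
  have h2 : ρ ^ 2 ≤ (2 * Real.pi * ρ) ^ 2 := by
    rw [mul_pow]
    refine le_mul_of_one_le_left (sq_nonneg _) (one_le_pow₀ ?_)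
    linarith [Real.pi_gt_three]
  rw [e, Real.norm_of_nonneg (by positivity)]
  calc _ ≤ 4 * 1 * (1 + (2 * Real.pi * ρ) ^ 2)⁻¹ := by gcongr
    _ ≤ _ := by rw [mul_one]; gcongr

/-- The Poisson averages of `h` tend to zero if the averages over centred intervals do. -/
theorem tendsto_lintegral_halfPlanePoisson_mul {h : ℝ → ℝ≥0∞} (hh : Measurable h) {M : ℝ≥0∞}
    (hM : M ≠ ∞) (hb : ∀ r : ℝ, 0 < r → ∫⁻ v in Ioo (-r) r, h v ≤ M * ENNReal.ofReal r)
    (h0 : Tendsto (fun r : ℝ => (∫⁻ v in Ioo (-r) r, h v) / ENNReal.ofReal r) (𝓝[>] 0) (𝓝 0)) :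
    Tendsto (fun σ => ∫⁻ v, ENNReal.ofReal (halfPlanePoisson σ v) * h v) (𝓝[>] 0) (𝓝 0) := by
  set A : ℝ → ℝ≥0∞ := fun r => ∫⁻ v in Ioo (-r) r, h v with hA
  have hAm : Measurable A := by
    refine Monotone.measurable fun r r' hr => lintegral_mono_set (Ioo_subset_Ioo ?_ hr)
    linarith
  have hQm : Measurable fun r => ENNReal.ofReal (halfPlanePoissonSlope 1 r) :=
    (continuous_halfPlanePoissonSlope one_pos).measurable.ennreal_ofReal
  have key : Tendsto (fun σ : ℝ => ∫⁻ ρ, ENNReal.ofReal (halfPlanePoissonSlope 1 ρ) *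
      (A (σ * ρ) / ENNReal.ofReal σ)) (𝓝[>] 0) (𝓝 (∫⁻ _ : ℝ, 0)) := by
    -- By `hb`, `A (σρ) / σ ≤ Mρ` for `ρ > 0`; for `ρ ≤ 0` the truncated weight is zero.
    refine tendsto_lintegral_filter_of_dominated_convergence
      (fun ρ => M * ENNReal.ofReal (halfPlanePoissonSlope 1 ρ * ρ))
      (.of_forall fun σ => ?_) ?_ ?_ ?_
    · exact hQm.mul ((hAm.comp (measurable_const_mul σ)).div_const _)
    · filter_upwards [self_mem_nhdsWithin] with σ hσ
      have hσ : 0 < σ := hσ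
      refine .of_forall fun ρ => ?_
      rcases le_or_gt ρ 0 with hρ | hρ
      · have := halfPlanePoissonSlope_nonpos one_pos hρ
        rw [ENNReal.ofReal_of_nonpos this, zero_mul]
        exact zero_le
      · rw [ENNReal.ofReal_mul' hρ.le, mul_left_comm]
        gcongr
        refine ENNReal.div_le_of_le_mul ((hb _ (mul_pos hσ hρ)).trans_eq ?_)
        rw [mul_comm σ, ENNReal.ofReal_mul hρ.le, mul_assoc]
    · rw [lintegral_const_mul' _ _ hM]
      refine ENNReal.mul_ne_top hM ?_
      refine ne_top_of_le_ne_top integrable_halfPlanePoissonSlope_mul_id.2.ne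
        (lintegral_mono fun ρ => ?_)
      exact Real.ofReal_le_enorm _
    · refine .of_forall fun ρ => ?_
      rcases le_or_gt ρ 0 with hρ | hρ
      · have := halfPlanePoissonSlope_nonpos one_pos hρ
        simp only [ENNReal.ofReal_of_nonpos this, zero_mul]
        exact tendsto_const_nhds
      · have ht : Tendsto (fun σ : ℝ => σ * ρ) (𝓝[>] 0) (𝓝[>] 0) := by
          refine tendsto_nhdsWithin_iff.mpr ⟨?_, ?_⟩
          · have : Tendsto (fun σ : ℝ => σ * ρ) (𝓝 0) (𝓝 (0 * ρ)) :=
              (continuous_mul_const ρ).tendsto 0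
            rw [zero_mul] at this
            exact this.mono_left nhdsWithin_le_nhds
          · filter_upwards [self_mem_nhdsWithin] with σ hσ
            exact mul_pos hσ hρ
        have h1 := ENNReal.Tendsto.const_mul (a := ENNReal.ofReal (halfPlanePoissonSlope 1 ρ) *
          ENNReal.ofReal ρ) (h0.comp ht) (Or.inr (by finiteness))
        rw [mul_zero] at h1
        refine h1.congr' ?_
        filter_upwards [self_mem_nhdsWithin] with σ hσ
        have hσ : 0 < σ := hσ
        have hρ0 : ENNReal.ofReal ρ ≠ 0 := by simpa using hρ
        simp only [Function.comp]
        rw [mul_comm σ ρ, ENNReal.ofReal_mul hρ.le, mul_assoc, div_eq_mul_inv, div_eq_mul_inv,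
          ENNReal.mul_inv (Or.inl hρ0) (Or.inl ENNReal.ofReal_ne_top)]
        congr 1
        calc _ = (ENNReal.ofReal ρ * (ENNReal.ofReal ρ)⁻¹) * (A (ρ * σ) * (ENNReal.ofReal σ)⁻¹) := by
              ring
          _ = _ := by rw [ENNReal.mul_inv_cancel hρ0 ENNReal.ofReal_ne_top, one_mul]
  rw [lintegral_zero] at key
  refine key.congr' ?_
  filter_upwards [self_mem_nhdsWithin] with σ hσ
  exact (lintegral_halfPlanePoisson_mul_scaled hσ hh).symm

/-- For small `r` the limit bounds the average by `1`. For `r ≥ ε`, the inequality `a ≤ 1 + a²`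
bounds the integral by `2r(1 + |g x|) + N`, and `N ≤ (N / ε) r`. -/
theorem exists_lintegral_centred_le {g : ℝ → ℂ} (hg : ∫⁻ x, ‖g x‖ₑ ^ 2 < ∞) {x : ℝ}
    (h0 : Tendsto (fun r : ℝ => (∫⁻ v in Ioo (-r) r, ‖g (v + x) - g x‖ₑ) / ENNReal.ofReal r)
      (𝓝[>] 0) (𝓝 0)) :
    ∃ M : ℝ≥0∞, M ≠ ∞ ∧ ∀ r : ℝ, 0 < r →
      ∫⁻ v in Ioo (-r) r, ‖g (v + x) - g x‖ₑ ≤ M * ENNReal.ofReal r := by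
  have hev := h0.eventually (ge_mem_nhds (zero_lt_one (α := ℝ≥0∞)))
  rw [eventually_nhdsWithin_iff, Metric.eventually_nhds_iff] at hev
  obtain ⟨ε, hε, hev⟩ := hev
  set N := ∫⁻ x, ‖g x‖ₑ ^ 2 with hN
  have hε0 : ENNReal.ofReal ε ≠ 0 := by simpa using hε
  refine ⟨1 + (2 * (1 + ‖g x‖ₑ) + N / ENNReal.ofReal ε), ?_, fun r hr => ?_⟩
  · have : N / ENNReal.ofReal ε ≠ ∞ := ENNReal.div_ne_top hg.ne hε0
    finiteness
  · rcases lt_or_ge r ε with hrε | hrε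
    · have h1 := hev (y := r) (by rwa [dist_zero_right, Real.norm_of_nonneg hr.le]) hr
      rw [ENNReal.div_le_iff (by simpa using hr) ENNReal.ofReal_ne_top] at h1
      refine h1.trans ?_
      gcongr
      exact le_self_add
    · have hpt : ∀ v, ‖g (v + x) - g x‖ₑ ≤ (1 + ‖g x‖ₑ) + ‖g (v + x)‖ₑ ^ 2 := by
        intro v
        have h1 : ‖g (v + x)‖ₑ ≤ 1 + ‖g (v + x)‖ₑ ^ 2 := by
          rcases le_total ‖g (v + x)‖ₑ 1 with h | h
          · exact h.trans le_self_add
          · exact (le_self_pow₀ h two_ne_zero).trans le_add_self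
        calc _ ≤ ‖g (v + x)‖ₑ + ‖g x‖ₑ := enorm_sub_le
          _ ≤ (1 + ‖g (v + x)‖ₑ ^ 2) + ‖g x‖ₑ := by gcongr
          _ = _ := by ring
      calc ∫⁻ v in Ioo (-r) r, ‖g (v + x) - g x‖ₑ
          ≤ ∫⁻ v in Ioo (-r) r, ((1 + ‖g x‖ₑ) + ‖g (v + x)‖ₑ ^ 2) := lintegral_mono fun v => hpt v
        _ = (1 + ‖g x‖ₑ) * volume (Ioo (-r) r) + ∫⁻ v in Ioo (-r) r, ‖g (v + x)‖ₑ ^ 2 := by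
          rw [lintegral_add_left measurable_const, setLIntegral_const]
        _ ≤ (1 + ‖g x‖ₑ) * volume (Ioo (-r) r) + N := by
          gcongr
          refine (setLIntegral_le_lintegral _ _).trans_eq ?_
          exact lintegral_add_right_eq_self (fun v => ‖g v‖ₑ ^ 2) x
        _ = 2 * (1 + ‖g x‖ₑ) * ENNReal.ofReal r + N := by
          rw [Real.volume_Ioo, show r - -r = 2 * r by ring, ENNReal.ofReal_mul zero_le_two,
            ENNReal.ofReal_ofNat]
          ring
        _ ≤ 2 * (1 + ‖g x‖ₑ) * ENNReal.ofReal r + N / ENNReal.ofReal ε * ENNReal.ofReal r := by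
          gcongr
          calc N = N / ENNReal.ofReal ε * ENNReal.ofReal ε :=
                (ENNReal.div_mul_cancel hε0 ENNReal.ofReal_ne_top).symm
            _ ≤ _ := by gcongr
        _ ≤ _ := by
          rw [← add_mul]
          exact mul_le_mul' le_add_self le_rfl

theorem tendsto_lintegral_centred_div {g : ℝ → ℂ} (hg : LocallyIntegrable g) :
    ∀ᵐ x : ℝ, Tendsto
      (fun r : ℝ => (∫⁻ v in Ioo (-r) r, ‖g (v + x) - g x‖ₑ) / ENNReal.ofReal r)
      (𝓝[>] 0) (𝓝 0) := by
  filter_upwards [IsUnifLocDoublingMeasure.ae_tendsto_average_norm_sub volume hg 1] with x hx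
  have h1 := hx (l := 𝓝[>] (0 : ℝ)) (fun _ => x) id tendsto_id (by
    filter_upwards [self_mem_nhdsWithin] with r hr
    have hr : 0 < r := hr
    simpa using hr.le)
  -- The factor `2` appears because the average divides by the length `2r`, the claim by `r`.
  have h2 := (ENNReal.tendsto_ofReal (h1.const_mul 2))
  rw [mul_zero, ENNReal.ofReal_zero] at h2
  refine tendsto_of_tendsto_of_tendsto_of_le_of_le' tendsto_const_nhds h2
    (.of_forall fun _ => zero_le) ?_
  filter_upwards [self_mem_nhdsWithin] with r hr
  have hr : 0 < r := hr
  have hr0 : ENNReal.ofReal r ≠ 0 := by simpa using hr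
  refine ENNReal.div_le_of_le_mul ?_
  have hint : IntegrableOn (fun y => g y - g x) (Metric.closedBall x r) :=
    (hg.integrableOn_isCompact (isCompact_closedBall x r)).sub
      (integrableOn_const (by rw [Real.volume_closedBall]; exact ENNReal.ofReal_ne_top))
  calc ∫⁻ v in Ioo (-r) r, ‖g (v + x) - g x‖ₑ
      = ∫⁻ v, (Metric.ball x r).indicator (fun y => ‖g y - g x‖ₑ) (v + x) := by
        rw [← lintegral_indicator measurableSet_Ioo]
        refine lintegral_congr fun v => ?_
        simp [indicator, abs_lt]
    _ = ∫⁻ y in Metric.ball x r, ‖g y - g x‖ₑ := by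
        rw [lintegral_add_right_eq_self, lintegral_indicator measurableSet_ball]
    _ ≤ ∫⁻ y in Metric.closedBall x r, ‖g y - g x‖ₑ :=
        lintegral_mono_set Metric.ball_subset_closedBall
    _ = ENNReal.ofReal (∫ y in Metric.closedBall x r, ‖g y - g x‖) :=
        (ofReal_integral_norm_eq_lintegral_enorm hint).symm
    _ = ENNReal.ofReal (2 * ⨍ y in Metric.closedBall x (id r), ‖g y - g x‖) * ENNReal.ofReal r := by
        rw [← ENNReal.ofReal_mul' hr.le, setAverage_eq]
        congr 1
        simp only [id, Measure.real, Real.volume_closedBall, smul_eq_mul]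
        rw [ENNReal.toReal_ofReal (by positivity)]
        field_simp

/-- The Poisson integral of an `L²` function converges to it almost everywhere. -/
theorem ae_tendsto_integral_halfPlanePoisson {g : ℝ → ℂ} (hgm : Measurable g) (hg : MemLp g 2) :
    ∀ᵐ x : ℝ, Tendsto (fun σ => ∫ u, (halfPlanePoisson σ (u - x) : ℂ) * g u)
      (𝓝[>] 0) (𝓝 (g x)) := by
  filter_upwards [tendsto_lintegral_centred_div (hg.locallyIntegrable (by norm_num))] with x hx
  obtain ⟨M, hM, hb⟩ := exists_lintegral_centred_le (lintegral_sq_lt_top_of_memLp hg) hx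
  have hlim := tendsto_lintegral_halfPlanePoisson_mul (by fun_prop) hM hb hx
  rw [tendsto_iff_edist_tendsto_0]
  refine tendsto_of_tendsto_of_tendsto_of_le_of_le' tendsto_const_nhds hlim
    (.of_forall fun _ => zero_le) ?_
  filter_upwards [self_mem_nhdsWithin] with σ hσ
  have hσ : 0 < σ := hσ
  have hsh : MemLp (fun v => g (v + x)) 2 :=
    hg.comp_measurePreserving (measurePreserving_add_right volume x)
  have hi1 : Integrable fun v => (halfPlanePoisson σ v : ℂ) * g (v + x) :=
    (memLp_two_halfPlanePoisson hσ).integrable_mul hsh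
  have hi2 : Integrable fun v => (halfPlanePoisson σ v : ℂ) * g x :=
    (integrable_halfPlanePoisson hσ).ofReal.mul_const _
  have e1 : ∫ u, (halfPlanePoisson σ (u - x) : ℂ) * g u =
      ∫ v, (halfPlanePoisson σ v : ℂ) * g (v + x) := by
    rw [← integral_add_right_eq_self (fun u => (halfPlanePoisson σ (u - x) : ℂ) * g u) x]
    simp
  have e2 : g x = ∫ v, (halfPlanePoisson σ v : ℂ) * g x := by
    rw [integral_mul_const, integral_complex_ofReal, integral_halfPlanePoisson hσ]
    simp
  rw [e1, edist_eq_enorm_sub]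
  conv_lhs => rw [e2]
  rw [← integral_sub hi1 hi2]
  refine (enorm_integral_le_lintegral_enorm _).trans (lintegral_mono fun v => ?_)
  rw [← mul_sub, enorm_mul, ← ofReal_norm, Complex.norm_real,
    Real.norm_of_nonneg (halfPlanePoisson_nonneg hσ v)]

/-- The Poisson representation of the Laplace transform by its boundary values. -/
theorem laplaceTransform_eq_integral_halfPlanePoisson (f : L2HalfLine) {σ : ℝ} (hσ : 0 < σ)
    (x : ℝ) :
    laplaceTransform f ((σ : ℂ) + ((2 * Real.pi * x : ℝ) : ℂ) * Complex.I) =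
      ∫ u, (halfPlanePoisson σ (u - x) : ℂ) *
        (𝓕 (extendByZero f) : Lp ℂ 2 (volume : Measure ℝ)) u := by
  -- Chosen so that `conj k` times the extension of `f` is the damped extension times `e^{-2πixt}`,
  -- while `𝓕 k` is the real Poisson kernel centred at `x`.
  set k : ℝ → ℂ := fun t => Complex.exp (-σ * |t| + (2 * Real.pi * x : ℝ) * t * Complex.I) with hk
  have hk1 : Integrable k := integrable_exp_mul_abs_complex hσ _
  have hk2 : MemLp k 2 := by
    refine (memLp_two_exp_neg_mul_abs hσ).of_le hk1.1 (.of_forall fun t => le_of_eq ?_)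
    simp [hk, Complex.norm_exp]
  have hFk : ∀ u, 𝓕 k u = (halfPlanePoisson σ (u - x) : ℂ) := by
    intro u
    have := integral_exp_mul_abs_complex hσ (-(2 * Real.pi * (u - x)))
    rw [Real.fourier_real_eq_integral_exp_smul, halfPlanePoisson, ← neg_sq (2 * Real.pi * (u - x)),
      ← this]
    refine integral_congr_ae (.of_forall fun t => ?_)
    simp only [hk, smul_eq_mul]
    rw [← Complex.exp_add]
    congr 1
    push_cast
    ring
  have hpl := Lp.inner_fourier_eq (hk2.toLp k) (extendByZero f)
  rw [L2.inner_def, L2.inner_def] at hpl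
  have e1 : ∫ u, inner ℂ ((𝓕 (hk2.toLp k) : Lp ℂ 2 (volume : Measure ℝ)) u)
      ((𝓕 (extendByZero f) : Lp ℂ 2 (volume : Measure ℝ)) u) =
      ∫ u, (halfPlanePoisson σ (u - x) : ℂ) *
        (𝓕 (extendByZero f) : Lp ℂ 2 (volume : Measure ℝ)) u := by
    refine integral_congr_ae ?_
    filter_upwards [fourier_toLp_two_ae_eq hk1 hk2] with u hu
    rw [hu, hFk, RCLike.inner_apply, Complex.conj_ofReal, mul_comm]
  rw [← e1, hpl, ← fourier_dampedExtension f hσ.ne', Real.fourier_real_eq_integral_exp_smul]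
  refine integral_congr_ae ?_
  filter_upwards [hk2.coeFn_toLp, (memLp_indicator_L2HalfLine f).coeFn_toLp] with t h1 h2
  rw [h1, extendByZero, h2, RCLike.inner_apply, hk, dampedExtension, smul_eq_mul, ← Complex.exp_conj,
    Complex.ofReal_exp, ← mul_assoc, ← Complex.exp_add, mul_comm]
  congr 2
  simp only [map_add, map_mul, map_neg, Complex.conj_ofReal, Complex.conj_I]
  push_cast
  ring

theorem ae_tendsto_laplaceTransform (f : L2HalfLine) :
    ∀ᵐ s : ℝ, Tendsto (fun σ : ℝ => laplaceTransform f ((σ : ℂ) + (s : ℂ) * Complex.I))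
      (𝓝[>] 0) (𝓝 (laplaceTransform f ((s : ℂ) * Complex.I))) := by
  have h2 : (2 * Real.pi) ≠ 0 := by positivity
  have h := ae_tendsto_integral_halfPlanePoisson
    (Lp.stronglyMeasurable (𝓕 (extendByZero f) : Lp ℂ 2 (volume : Measure ℝ))).measurable
    (Lp.memLp _)
  filter_upwards [quasiMeasurePreserving_div_two_pi.ae h] with s hs
  have e : laplaceTransform f ((s : ℂ) * Complex.I) =
      (𝓕 (extendByZero f) : Lp ℂ 2 (volume : Measure ℝ)) (s / (2 * Real.pi)) := by
    rw [laplaceTransform, if_pos (by simp)]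
    simp
  rw [e]
  refine hs.congr' ?_
  filter_upwards [self_mem_nhdsWithin] with σ hσ
  rw [← laplaceTransform_eq_integral_halfPlanePoisson f hσ, mul_div_cancel₀ _ h2]

/-! ### Shifting vertical lines of integration -/

theorem continuous_vertical {H : ℂ → ℂ} (hH : ContinuousOn H {p : ℂ | 0 < p.re}) {σ : ℝ}
    (hσ : 0 < σ) : Continuous fun s : ℝ => H ((σ : ℂ) + (s : ℂ) * Complex.I) :=
  hH.comp_continuous (by fun_prop) fun s => by simpa using hσ

theorem integrable_strip {H : ℂ → ℂ} (hH : ContinuousOn H {p : ℂ | 0 < p.re}) {a b : ℝ}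
    (ha : 0 < a) {C : ℝ≥0∞} (hC : C ≠ ∞)
    (hb : ∀ σ ∈ Icc a b, ∫⁻ s : ℝ, ‖H ((σ : ℂ) + (s : ℂ) * Complex.I)‖ₑ ≤ C) :
    Integrable (fun z : ℝ × ℝ => H ((z.1 : ℂ) + (z.2 : ℂ) * Complex.I))
      ((volume.restrict (Ioc a b)).prod volume) := by
  have hm : AEStronglyMeasurable (fun z : ℝ × ℝ => H ((z.1 : ℂ) + (z.2 : ℂ) * Complex.I))
      ((volume.restrict (Ioc a b)).prod volume) := by
    have h1 : ContinuousOn (fun z : ℝ × ℝ => H ((z.1 : ℂ) + (z.2 : ℂ) * Complex.I))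
        (Ioc a b ×ˢ univ) :=
      hH.comp (by fun_prop) fun z hz => by simpa using ha.trans hz.1.1
    have h2 := h1.aestronglyMeasurable (μ := volume.prod volume)
      (measurableSet_Ioc.prod MeasurableSet.univ)
    rwa [← Measure.prod_restrict, Measure.restrict_univ] at h2
  refine ⟨hm, ?_⟩
  rw [HasFiniteIntegral, lintegral_prod _ hm.enorm]
  calc _ ≤ ∫⁻ _ in Ioc a b, C :=
        setLIntegral_mono measurable_const fun σ hσ => hb σ (Ioc_subset_Icc_self hσ)
    _ < ∞ := by
        rw [setLIntegral_const, Real.volume_Ioc]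
        finiteness

/-- Cauchy's theorem on rectangles of height `2T`. No pointwise decay of `H` is needed: the
horizontal sides `e T` form an integrable function of `T`, by Fubini on the strip. -/
theorem integral_vertical_eq {H : ℂ → ℂ} (hH : DifferentiableOn ℂ H {p : ℂ | 0 < p.re}) {a b : ℝ}
    (ha : 0 < a) (hab : a ≤ b) {C : ℝ≥0∞} (hC : C ≠ ∞)
    (hb : ∀ σ ∈ Icc a b, ∫⁻ s : ℝ, ‖H ((σ : ℂ) + (s : ℂ) * Complex.I)‖ₑ ≤ C) :
    ∫ s : ℝ, H ((a : ℂ) + (s : ℂ) * Complex.I) = ∫ s : ℝ, H ((b : ℂ) + (s : ℂ) * Complex.I) := by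
  have hline : ∀ σ ∈ Icc a b, Integrable fun s : ℝ => H ((σ : ℂ) + (s : ℂ) * Complex.I) :=
    fun σ hσ => ⟨(continuous_vertical hH.continuousOn (ha.trans_le hσ.1)).aestronglyMeasurable,
      (hb σ hσ).trans_lt hC.lt_top⟩
  set e : ℝ → ℂ := fun T => ∫ x in a..b, H ((x : ℂ) + (T : ℂ) * Complex.I) with he
  have hei : Integrable e := by
    have := (integrable_strip hH.continuousOn ha hC hb).integral_prod_right
    refine this.congr (.of_forall fun T => ?_)
    simp only [he, intervalIntegral.integral_of_le hab]
  have hrect : ∀ T : ℝ, e T - e (-T) =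
      Complex.I * ((∫ y in -T..T, H ((b : ℂ) + (y : ℂ) * Complex.I)) -
        ∫ y in -T..T, H ((a : ℂ) + (y : ℂ) * Complex.I)) := by
    intro T
    have h := Complex.integral_boundary_rect_eq_zero_of_differentiableOn H
      (⟨a, -T⟩ : ℂ) ⟨b, T⟩ (hH.mono fun p hp => by
        have h1 := (Complex.mem_reProdIm.mp hp).1
        simp only [uIcc_of_le hab] at h1
        exact ha.trans_le h1.1)
    simp only [smul_eq_mul] at h
    simp only [he]
    linear_combination -h
  have hlim : Tendsto (fun T => e T - e (-T)) atTop
      (𝓝 (Complex.I * ((∫ s : ℝ, H ((b : ℂ) + (s : ℂ) * Complex.I)) -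
        ∫ s : ℝ, H ((a : ℂ) + (s : ℂ) * Complex.I)))) := by
    simp only [hrect]
    refine Tendsto.const_mul _ (Tendsto.sub ?_ ?_)
    · exact intervalIntegral_tendsto_integral (hline b ⟨hab, le_rfl⟩) tendsto_neg_atTop_atBot
        tendsto_id
    · exact intervalIntegral_tendsto_integral (hline a ⟨le_rfl, hab⟩) tendsto_neg_atTop_atBot
        tendsto_id
  -- An integrable function with a limit at infinity has limit zero, since half-lines have infinite
  -- measure.
  have hz := IntegrableAtFilter.eq_zero_of_tendsto (μ := volume)
    ((hei.sub hei.comp_neg).integrableAtFilter atTop) (fun s hs => by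
      obtain ⟨c, hc⟩ := mem_atTop_sets.mp hs
      refine top_le_iff.mp ((Real.volume_Ici (a := c)).symm.le.trans (measure_mono hc))) hlim
  have := (mul_eq_zero.mp hz).resolve_left Complex.I_ne_zero
  exact (sub_eq_zero.mp this).symm

/-! ### Pairing with test functions -/

/-- The two-sided Laplace integral `∫ e^{pt} φ(t) dt` of a real function. -/
noncomputable def bilateralLaplace (φ : ℝ → ℝ) (p : ℂ) : ℂ :=
  ∫ t : ℝ, Complex.exp (p * t) * φ t

theorem integrable_of_continuous_mul {φ : ℝ → ℝ} (hφ : Continuous φ) (hc : HasCompactSupport φ)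
    {w : ℝ → ℂ} (hw : Continuous w) : Integrable fun t => w t * φ t := by
  have hc' : HasCompactSupport fun t => (φ t : ℂ) :=
    hc.comp_left (g := fun x : ℝ => (x : ℂ)) (by simp)
  exact (hw.mul (Complex.continuous_ofReal.comp hφ)).integrable_of_hasCompactSupport hc'.mul_left

theorem memLp_of_continuous_mul {φ : ℝ → ℝ} (hφ : Continuous φ) (hc : HasCompactSupport φ)
    {w : ℝ → ℂ} (hw : Continuous w) : MemLp (fun t => w t * φ t) 2 := by
  have hc' : HasCompactSupport fun t => (φ t : ℂ) :=
    hc.comp_left (g := fun x : ℝ => (x : ℂ)) (by simp)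
  exact (hw.mul (Complex.continuous_ofReal.comp hφ)).memLp_of_hasCompactSupport hc'.mul_left

theorem differentiable_bilateralLaplace {φ : ℝ → ℝ} (hφ : Continuous φ)
    (hc : HasCompactSupport φ) : Differentiable ℂ (bilateralLaplace φ) := by
  intro p
  have h : ∀ c : ℝ, Integrable fun t : ℝ => Real.exp (c * t) * ‖(φ t : ℂ)‖ := by
    intro c
    refine (integrable_of_continuous_mul hφ hc (w := fun t => (Real.exp (c * t) : ℂ))
      (by fun_prop)).norm.congr (.of_forall fun t => ?_)
    simp only
    rw [norm_mul, Complex.norm_real, Real.norm_of_nonneg (Real.exp_pos _).le]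
  exact differentiableAt_integral_exp_mul (w := fun t => (φ t : ℂ))
    (Continuous.aestronglyMeasurable (by fun_prop)) one_pos (h _) (h _)

/-- As `φ` is real, the conjugation in the inner product turns its Fourier transform into a function
holomorphic in `p`, to which Cauchy's theorem applies. -/
theorem conj_fourier_exp_mul {φ : ℝ → ℝ} (σ ξ : ℝ) :
    (starRingEnd ℂ) (𝓕 (fun t : ℝ => (Real.exp (σ * t) : ℂ) * φ t) ξ) =
      bilateralLaplace φ ((σ : ℂ) + ((2 * Real.pi * ξ : ℝ) : ℂ) * Complex.I) := by
  rw [Real.fourier_real_eq_integral_exp_smul, ← integral_conj, bilateralLaplace]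
  refine integral_congr_ae (.of_forall fun t => ?_)
  simp only [smul_eq_mul, map_mul, ← Complex.exp_conj, Complex.conj_ofReal, Complex.conj_I]
  rw [← mul_assoc, Complex.ofReal_exp, ← Complex.exp_add]
  congr 2
  push_cast
  ring

theorem verticalL2_bilateralLaplace {φ : ℝ → ℝ} (hφ : Continuous φ) (hc : HasCompactSupport φ)
    (σ : ℝ) : verticalL2 (bilateralLaplace φ) σ =
      ENNReal.ofReal (2 * Real.pi) * ∫⁻ t : ℝ, ‖(Real.exp (σ * t) : ℂ) * φ t‖ₑ ^ 2 := by
  have h1 := integrable_of_continuous_mul hφ hc (w := fun t => (Real.exp (σ * t) : ℂ)) (by fun_prop)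
  have h2 := memLp_of_continuous_mul hφ hc (w := fun t => (Real.exp (σ * t) : ℂ)) (by fun_prop)
  rw [verticalL2_eq_of_ae_eq (G := fun ξ => (starRingEnd ℂ)
    ((𝓕 (h2.toLp _) : Lp ℂ 2 (volume : Measure ℝ)) ξ)), ← lintegral_fourier_toLp h2]
  · refine congrArg _ (lintegral_congr fun ξ => ?_)
    rw [← ofReal_norm, ← ofReal_norm, RCLike.norm_conj]
  · filter_upwards [fourier_toLp_two_ae_eq h1 h2] with ξ hξ
    rw [hξ, conj_fourier_exp_mul]

theorem lintegral_vertical_mul_le {Ψ F : ℂ → ℂ} (hΨ : Continuous Ψ) (σ : ℝ) :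
    ∫⁻ s : ℝ, ‖(fun p => Ψ p * F p) ((σ : ℂ) + (s : ℂ) * Complex.I)‖ₑ ≤
      verticalL2 Ψ σ + verticalL2 F σ := by
  rw [verticalL2, verticalL2, ← lintegral_add_left (Continuous.measurable (by fun_prop))]
  refine lintegral_mono fun s => ?_
  simp only [enorm_mul]
  generalize ‖Ψ ((σ : ℂ) + (s : ℂ) * Complex.I)‖ₑ = x
  generalize ‖F ((σ : ℂ) + (s : ℂ) * Complex.I)‖ₑ = y
  rcases le_total x y with h | h
  · calc x * y ≤ y ^ 2 := by rw [sq]; gcongr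
      _ ≤ _ := le_add_self
  · calc x * y ≤ x ^ 2 := by rw [sq]; gcongr
      _ ≤ _ := le_self_add

theorem integral_bilateralLaplace_mul_eq {F : ℂ → ℂ}
    (hF : DifferentiableOn ℂ F {p : ℂ | 0 < p.re}) {M : ℝ≥0∞} (hM : M ≠ ∞)
    (hb : ∀ σ : ℝ, 0 < σ → verticalL2 F σ ≤ M) {φ : ℝ → ℝ} (hφ : Continuous φ)
    (hc : HasCompactSupport φ) {a b : ℝ} (ha : 0 < a) (hab : a ≤ b) :
    ∫ s : ℝ, (fun p => bilateralLaplace φ p * F p) ((a : ℂ) + (s : ℂ) * Complex.I) =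
      ∫ s : ℝ, (fun p => bilateralLaplace φ p * F p) ((b : ℂ) + (s : ℂ) * Complex.I) := by
  have hΨ := differentiable_bilateralLaplace hφ hc
  have hfin := lintegral_sq_lt_top_of_memLp
    (memLp_of_continuous_mul hφ hc (w := fun t => (Real.exp (b * |t|) : ℂ)) (by fun_prop))
  refine integral_vertical_eq (hΨ.differentiableOn.mul hF) ha hab
    -- The weight `e^{b|t|}` dominates `e^{σt}` for all `σ ∈ [a, b]`, so the bound is uniform over
    -- the strip.
    (C := ENNReal.ofReal (2 * Real.pi) * (∫⁻ t : ℝ, ‖(Real.exp (b * |t|) : ℂ) * φ t‖ₑ ^ 2) + M)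
    (by finiteness) fun σ hσ => ?_
  refine (lintegral_vertical_mul_le hΨ.continuous σ).trans ?_
  rw [verticalL2_bilateralLaplace hφ hc]
  gcongr with t
  · simp only [enorm_mul]
    gcongr
    rw [enorm_le_iff_norm_le, Complex.norm_real, Complex.norm_real,
      Real.norm_of_nonneg (Real.exp_pos _).le, Real.norm_of_nonneg (Real.exp_pos _).le]
    refine Real.exp_le_exp.mpr ?_
    calc σ * t ≤ σ * |t| := by
          have := ha.trans_le hσ.1
          gcongr
          exact le_abs_self t
      _ ≤ b * |t| := by gcongr; exact hσ.2
  · exact hb σ (ha.trans_le hσ.1)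

/-- Plancherel, followed by `s = 2πξ`, whose Jacobian is the factor `(2π)⁻¹`. -/
theorem integral_exp_mul_Lp_eq (φ : ℝ → ℝ) (hφ : Continuous φ) (hc : HasCompactSupport φ)
    (σ : ℝ) (u : Lp ℂ 2 (volume : Measure ℝ)) {F : ℂ → ℂ}
    (hu : ∀ᵐ ξ : ℝ, (𝓕 u : Lp ℂ 2 (volume : Measure ℝ)) ξ =
      F ((σ : ℂ) + ((2 * Real.pi * ξ : ℝ) : ℂ) * Complex.I)) :
    ∫ t : ℝ, φ t • ((Real.exp (σ * t) : ℂ) * u t) = (((2 * Real.pi)⁻¹ : ℝ) : ℂ) *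
      ∫ s : ℝ, (fun p => bilateralLaplace φ p * F p) ((σ : ℂ) + (s : ℂ) * Complex.I) := by
  have h1 := integrable_of_continuous_mul hφ hc (w := fun t => (Real.exp (σ * t) : ℂ)) (by fun_prop)
  have h2 := memLp_of_continuous_mul hφ hc (w := fun t => (Real.exp (σ * t) : ℂ)) (by fun_prop)
  have hpl := Lp.inner_fourier_eq (h2.toLp _) u
  rw [L2.inner_def, L2.inner_def] at hpl
  have hsc := Measure.integral_comp_mul_left
    (fun s : ℝ => (fun p => bilateralLaplace φ p * F p) ((σ : ℂ) + (s : ℂ) * Complex.I))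
    (2 * Real.pi)
  rw [abs_of_pos (by positivity), Complex.real_smul] at hsc
  rw [← hsc]
  calc ∫ t : ℝ, φ t • ((Real.exp (σ * t) : ℂ) * u t)
      = ∫ t, inner ℂ ((h2.toLp _ : Lp ℂ 2 (volume : Measure ℝ)) t) (u t) := by
        refine integral_congr_ae ?_
        filter_upwards [h2.coeFn_toLp] with t ht
        rw [ht, RCLike.inner_apply, Complex.real_smul, map_mul, Complex.conj_ofReal,
          Complex.conj_ofReal]
        ring
    _ = _ := hpl.symm
    _ = _ := by
        refine integral_congr_ae ?_
        filter_upwards [fourier_toLp_two_ae_eq h1 h2, hu] with ξ h3 h4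
        rw [h3, h4, RCLike.inner_apply, conj_fourier_exp_mul, mul_comm]

/-! ### The converse: functions with bounded vertical square integrals are Laplace transforms -/

theorem exists_Lp_fourier_eq_vertical {F : ℂ → ℂ} (hF : ContinuousOn F {p : ℂ | 0 < p.re})
    {M : ℝ≥0∞} (hM : M ≠ ∞) {σ : ℝ} (hσ : 0 < σ) (hb : verticalL2 F σ ≤ M) :
    ∃ u : Lp ℂ 2 (volume : Measure ℝ),
      (∀ᵐ ξ : ℝ, (𝓕 u : Lp ℂ 2 (volume : Measure ℝ)) ξ =
        F ((σ : ℂ) + ((2 * Real.pi * ξ : ℝ) : ℂ) * Complex.I)) ∧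
      ∫⁻ t, ‖u t‖ₑ ^ 2 ≤ M / ENNReal.ofReal (2 * Real.pi) := by
  have h2 : ENNReal.ofReal (2 * Real.pi) ≠ 0 := by
    simpa using Real.pi_pos
  have hc : Continuous fun ξ : ℝ => F ((σ : ℂ) + ((2 * Real.pi * ξ : ℝ) : ℂ) * Complex.I) :=
    (continuous_vertical hF hσ).comp (continuous_const_mul (2 * Real.pi))
  have hle : ∫⁻ ξ : ℝ, ‖F ((σ : ℂ) + ((2 * Real.pi * ξ : ℝ) : ℂ) * Complex.I)‖ₑ ^ 2 ≤
      M / ENNReal.ofReal (2 * Real.pi) := by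
    rw [ENNReal.le_div_iff_mul_le (Or.inl h2) (Or.inl ENNReal.ofReal_ne_top), mul_comm,
      ← verticalL2_eq_of_ae_eq (.of_forall fun _ => rfl)]
    exact hb
  have hm : MemLp (fun ξ : ℝ => F ((σ : ℂ) + ((2 * Real.pi * ξ : ℝ) : ℂ) * Complex.I)) 2 :=
    memLp_two_of_lintegral_lt_top hc.aestronglyMeasurable
      (hle.trans_lt (ENNReal.div_lt_top hM h2))
  have hinv : 𝓕 (𝓕⁻ (hm.toLp _)) = hm.toLp _ := FourierTransform.fourier_fourierInv_eq _
  refine ⟨𝓕⁻ (hm.toLp _), ?_, ?_⟩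
  · rw [hinv]
    exact hm.coeFn_toLp
  · have h := lintegral_fourier_toLp (Lp.memLp (𝓕⁻ (hm.toLp _)))
    rw [Lp.toLp_coeFn, hinv] at h
    rw [← h]
    refine le_of_eq_of_le (lintegral_congr_ae ?_) hle
    filter_upwards [hm.coeFn_toLp] with ξ hξ
    rw [hξ]

theorem locallyIntegrable_exp_mul_Lp (σ : ℝ) (u : Lp ℂ 2 (volume : Measure ℝ)) :
    LocallyIntegrable fun t : ℝ => (Real.exp (σ * t) : ℂ) * u t := by
  rw [locallyIntegrable_iff]
  intro k hk
  exact (((Lp.memLp u).locallyIntegrable (by norm_num)).integrableOn_isCompact hk).continuousOn_mul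
    (Continuous.continuousOn (by fun_prop)) hk

/-- Both sides have the same pairing with every test function, by shifting the line of integration.
-/
theorem exp_mul_ae_eq_exp_mul {F : ℂ → ℂ} (hF : DifferentiableOn ℂ F {p : ℂ | 0 < p.re})
    {M : ℝ≥0∞} (hM : M ≠ ∞) (hb : ∀ σ : ℝ, 0 < σ → verticalL2 F σ ≤ M) {a b : ℝ} (ha : 0 < a)
    (hb' : 0 < b) {u v : Lp ℂ 2 (volume : Measure ℝ)}
    (hu : ∀ᵐ ξ : ℝ, (𝓕 u : Lp ℂ 2 (volume : Measure ℝ)) ξ =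
      F ((a : ℂ) + ((2 * Real.pi * ξ : ℝ) : ℂ) * Complex.I))
    (hv : ∀ᵐ ξ : ℝ, (𝓕 v : Lp ℂ 2 (volume : Measure ℝ)) ξ =
      F ((b : ℂ) + ((2 * Real.pi * ξ : ℝ) : ℂ) * Complex.I)) :
    ∀ᵐ t : ℝ, (Real.exp (a * t) : ℂ) * u t = (Real.exp (b * t) : ℂ) * v t := by
  refine ae_eq_of_integral_contDiff_smul_eq (locallyIntegrable_exp_mul_Lp a u)
    (locallyIntegrable_exp_mul_Lp b v) fun φ hφ hc => ?_
  rw [integral_exp_mul_Lp_eq φ hφ.continuous hc a u hu,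
    integral_exp_mul_Lp_eq φ hφ.continuous hc b v hv]
  rcases le_total a b with hab | hab
  · rw [integral_bilateralLaplace_mul_eq hF hM hb hφ.continuous hc ha hab]
  · rw [integral_bilateralLaplace_mul_eq hF hM hb hφ.continuous hc hb' hab]

theorem enorm_exp_mul_sq (σ t : ℝ) (z : ℂ) :
    ‖(Real.exp (-σ * t) : ℂ) * z‖ₑ ^ 2 = ENNReal.ofReal (Real.exp (-σ * t)) ^ 2 * ‖z‖ₑ ^ 2 := by
  rw [enorm_mul, mul_pow, ← ofReal_norm (Real.exp _ : ℂ), Complex.norm_real,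
    Real.norm_of_nonneg (Real.exp_pos _).le]

/-- Fatou's lemma along `σ = 1/(n+1) → 0`. -/
theorem lintegral_sq_le_of_exp_mul {g : ℝ → ℂ} (hg : AEStronglyMeasurable g) {M : ℝ≥0∞}
    (hb : ∀ σ : ℝ, 0 < σ → ∫⁻ t, ‖(Real.exp (-σ * t) : ℂ) * g t‖ₑ ^ 2 ≤ M) :
    ∫⁻ t, ‖g t‖ₑ ^ 2 ≤ M := by
  have hm : ∀ n : ℕ, AEMeasurable fun t =>
      ‖(Real.exp (-(1 / ((n : ℝ) + 1)) * t) : ℂ) * g t‖ₑ ^ 2 := fun n =>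
    ((Continuous.aestronglyMeasurable (by fun_prop)).mul hg).enorm.pow_const 2
  have hF := lintegral_liminf_le' (u := atTop) hm
  have hlim : ∀ t : ℝ, liminf (fun n : ℕ =>
      ‖(Real.exp (-(1 / ((n : ℝ) + 1)) * t) : ℂ) * g t‖ₑ ^ 2) atTop = ‖g t‖ₑ ^ 2 := by
    intro t
    refine Tendsto.liminf_eq ?_
    have hcont : Continuous fun x : ℝ => ‖(Real.exp (-x * t) : ℂ) * g t‖ₑ ^ 2 := by fun_prop
    have := (hcont.tendsto 0).comp (tendsto_one_div_add_atTop_nhds_zero_nat (𝕜 := ℝ))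
    simpa [Function.comp_def] using this
  simp only [hlim] at hF
  refine hF.trans (liminf_le_of_frequently_le' (Frequently.of_forall fun n => hb _ (by positivity)))

/-- Fatou's lemma along `σ = n + 1 → ∞`: the lower limit is finite a.e., but at `t < 0` it is
infinite unless `g t = 0`. -/
theorem ae_eq_zero_of_exp_mul {g : ℝ → ℂ} (hg : Measurable g) {M : ℝ≥0∞} (hM : M ≠ ∞)
    (hb : ∀ σ : ℝ, 0 < σ → ∫⁻ t, ‖(Real.exp (-σ * t) : ℂ) * g t‖ₑ ^ 2 ≤ M) :
    ∀ᵐ t : ℝ, t < 0 → g t = 0 := by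
  have hm : ∀ n : ℕ, Measurable fun t =>
      ‖(Real.exp (-((n : ℝ) + 1) * t) : ℂ) * g t‖ₑ ^ 2 := fun n => by fun_prop
  have hF := (lintegral_liminf_le (u := atTop) hm).trans
    (liminf_le_of_frequently_le' (Frequently.of_forall fun n => hb _ (by positivity)))
  filter_upwards [ae_lt_top (Measurable.liminf hm) (hF.trans_lt hM.lt_top).ne] with t ht htn
  by_contra hz
  refine ht.ne (Tendsto.liminf_eq ?_)
  simp only [enorm_exp_mul_sq]
  have h1 : Tendsto (fun n : ℕ => -((n : ℝ) + 1) * t) atTop atTop := by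
    have h2 : Tendsto (fun n : ℕ => ((n : ℝ) + 1)) atTop atTop :=
      tendsto_atTop_add_const_right _ _ tendsto_natCast_atTop_atTop
    refine (h2.atTop_mul_const (neg_pos.mpr htn)).congr fun n => ?_
    ring
  have h3 := ENNReal.tendsto_ofReal_atTop.comp (Real.tendsto_exp_atTop.comp h1)
  have h4 := ENNReal.Tendsto.mul_const (b := ‖g t‖ₑ ^ 2) (ENNReal.Tendsto.pow (n := 2) h3)
    (Or.inl (by simp))
  have h5 : ‖g t‖ₑ ^ 2 ≠ 0 := by simpa using hz
  rw [ENNReal.top_pow two_ne_zero, ENNReal.top_mul h5] at h4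
  exact h4

theorem exists_laplaceTransform_eq {F : ℂ → ℂ} (hF : DifferentiableOn ℂ F {p : ℂ | 0 < p.re})
    {M : ℝ≥0∞} (hM : M ≠ ∞) (hb : ∀ σ : ℝ, 0 < σ → verticalL2 F σ ≤ M) :
    ∃ f : L2HalfLine, ∀ p : ℂ, 0 < p.re → F p = laplaceTransform f p := by
  have h2 : (2 * Real.pi) ≠ 0 := by positivity
  choose u hu hub using fun (σ : ℝ) (hσ : 0 < σ) =>
    exists_Lp_fourier_eq_vertical hF.continuousOn hM hσ (hb σ hσ)
  -- The line `σ = 1` is an arbitrary reference; any other gives the same `g` a.e.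
  set g : ℝ → ℂ := fun t => (Real.exp (1 * t) : ℂ) * u 1 one_pos t with hg
  have hgm : Measurable g :=
    (Continuous.measurable (by fun_prop)).mul (Lp.stronglyMeasurable _).measurable
  have hug : ∀ (σ : ℝ) (hσ : 0 < σ), ∀ᵐ t : ℝ, u σ hσ t = (Real.exp (-σ * t) : ℂ) * g t := by
    intro σ hσ
    filter_upwards [exp_mul_ae_eq_exp_mul hF hM hb hσ one_pos (hu σ hσ) (hu 1 one_pos)] with t ht
    simp only [hg]
    rw [← ht, ← mul_assoc, ← Complex.ofReal_mul, ← Real.exp_add]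
    simp
  have hM' : M / ENNReal.ofReal (2 * Real.pi) ≠ ∞ :=
    ENNReal.div_ne_top hM (by simpa using Real.pi_pos)
  have hgb : ∀ σ : ℝ, 0 < σ → ∫⁻ t, ‖(Real.exp (-σ * t) : ℂ) * g t‖ₑ ^ 2 ≤
      M / ENNReal.ofReal (2 * Real.pi) := by
    intro σ hσ
    refine le_of_eq_of_le (lintegral_congr_ae ?_) (hub σ hσ)
    filter_upwards [hug σ hσ] with t ht
    rw [ht]
  have hg2 : MemLp g 2 := memLp_two_of_lintegral_lt_top hgm.aestronglyMeasurable
    ((lintegral_sq_le_of_exp_mul hgm.aestronglyMeasurable hgb).trans_lt hM'.lt_top)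
  have hg2' : MemLp g 2 (volume.restrict (Ioi (0 : ℝ))) := hg2.restrict _
  refine ⟨hg2'.toLp g, fun p hp => ?_⟩
  set f : L2HalfLine := hg2'.toLp g with hf
  have hdu : dampedExtension f p.re =ᵐ[volume] u p.re hp := by
    filter_upwards [hug p.re hp, ae_eq_zero_of_exp_mul hgm hM' hgb, Measure.ae_ne volume 0,
      (ae_restrict_iff' measurableSet_Ioi).mp hg2'.coeFn_toLp] with t h1 h3 h4 h5
    rw [h1, dampedExtension]
    rcases lt_or_gt_of_ne h4 with ht | ht
    · rw [indicator_of_notMem (by simpa using ht.le), h3 ht, mul_zero, mul_zero]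
    · rw [indicator_of_mem (mem_Ioi.mpr ht), abs_of_pos ht, h5 ht]
  have hi := integrable_dampedExtension f hp
  have hm := memLp_dampedExtension f hp.le
  have htoLp : hm.toLp _ = u p.re hp := by
    rw [← Lp.toLp_coeFn (u p.re hp) (Lp.memLp _)]
    exact (MemLp.toLp_eq_toLp_iff _ _).mpr hdu
  have hae : 𝓕 (dampedExtension f p.re) =ᵐ[volume]
      fun ξ : ℝ => F ((p.re : ℂ) + ((2 * Real.pi * ξ : ℝ) : ℂ) * Complex.I) := by
    filter_upwards [fourier_toLp_two_ae_eq hi hm, hu p.re hp] with ξ h1 h3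
    rw [← h1, htoLp, h3]
  have hc1 : Continuous (𝓕 (dampedExtension f p.re)) :=
    VectorFourier.fourierIntegral_continuous Real.continuous_fourierChar
      (innerSL ℝ).continuous₂ hi
  have hc2 : Continuous fun ξ : ℝ => F ((p.re : ℂ) + ((2 * Real.pi * ξ : ℝ) : ℂ) * Complex.I) :=
    (continuous_vertical hF.continuousOn hp).comp (continuous_const_mul (2 * Real.pi))
  -- Both sides are continuous along the line, so a.e. equality holds at every point, in particular
  -- at `p`.
  have h := congrFun ((Continuous.ae_eq_iff_eq volume hc1 hc2).mp hae) (p.im / (2 * Real.pi))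
  rw [fourier_dampedExtension f hp.ne', mul_div_cancel₀ _ h2, Complex.re_add_im] at h
  exact h.symm

theorem proposition1 :
    (∀ f : L2HalfLine,
      (∀ p : ℂ, 0 < p.re →
        IntegrableOn (fun t : ℝ => Complex.exp (-p * (t : ℂ)) * f t) (Ioi 0)) ∧
      AnalyticOnNhd ℂ (laplaceTransform f) {p : ℂ | 0 < p.re} ∧
      (∀ᵐ s : ℝ, Tendsto (fun σ : ℝ => laplaceTransform f ((σ : ℂ) + (s : ℂ) * Complex.I))
        (𝓝[>] 0) (𝓝 (laplaceTransform f ((s : ℂ) * Complex.I)))) ∧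
      (⨆ σ ∈ Ici (0 : ℝ), verticalL2 (laplaceTransform f) σ) < ∞) ∧
    (∀ F : ℂ → ℂ, AnalyticOnNhd ℂ F {p : ℂ | 0 < p.re} →
      (⨆ σ ∈ Ioi (0 : ℝ), verticalL2 F σ) < ∞ →
      ∃ f : L2HalfLine,
        (∀ p : ℂ, 0 < p.re → F p = laplaceTransform f p) ∧
        (∀ᵐ s : ℝ, Tendsto (fun σ : ℝ => F ((σ : ℂ) + (s : ℂ) * Complex.I))
          (𝓝[>] 0) (𝓝 (laplaceTransform f ((s : ℂ) * Complex.I))))) := by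
  refine ⟨fun f => ⟨fun p hp => integrableOn_exp_mul f hp, analyticOnNhd_laplaceTransform f,
    ae_tendsto_laplaceTransform f, ?_⟩, fun F hF hb => ?_⟩
  · refine (iSup₂_le fun σ (hσ : σ ∈ Ici (0 : ℝ)) => verticalL2_laplaceTransform_le f hσ).trans_lt ?_
    exact ENNReal.mul_lt_top ENNReal.ofReal_lt_top
      (lintegral_sq_lt_top_of_memLp (memLp_indicator_L2HalfLine f))
  · obtain ⟨f, hf⟩ := exists_laplaceTransform_eq hF.differentiableOn hb.ne
      fun σ hσ => le_iSup₂ (f := fun (σ : ℝ) (_ : σ ∈ Ioi (0 : ℝ)) => verticalL2 F σ) σ hσ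
    refine ⟨f, hf, ?_⟩
    filter_upwards [ae_tendsto_laplaceTransform f] with s hs
    refine hs.congr' ?_
    filter_upwards [self_mem_nhdsWithin] with σ hσ
    exact (hf _ (by simpa using hσ)).symm
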